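/- Let $A_1,\dots,A_d\in\mathbb R^{n\times n}$ be symmetric matrices that commute pairwise, and let $E_1,\dots,E_d\in\mathbb R^{n\times n}$ be symmetric matrices with $\big(\|E_1\|_F^2+\cdots+\|E_d\|_F^2\big)^{1/2}\le\epsilon$, where $\epsilon>0$ and $\|\cdot\|_F$ is the Frobenius norm. Put $\tilde A_k=A_k+E_k$. Let $\mu_1,\dots,\mu_d$ be independent standard normal random variables on a probability space, and let $\tilde Q$ be any random matrix that is almost surely orthogonal and diagonalizes $\tilde A(\mu)=\mu_1\tilde A_1+\cdots+\mu_d\tilde A_d$, that is, $\tilde Q^T\tilde Q=I$ and $\tilde Q^T\tilde A(\mu)\tilde Q$ is diagonal almost surely. For a square matrix $M$ let $\operatorname{offdiag}(M)$ be the matrix obtained from $M$ by setting its diagonal entries to zero. Then for every $R>1$, $$\mathbb P\Big(\Big(\sum_{k=1}^d\big\|\operatorname{offdiag}(\tilde Q^T\tilde A_k\tilde Q)\big\|_F^2\Big)^{1/2}\le R\,\epsilon\Big)\ \ge\ 1-\frac{6}{\sqrt\pi}\,\frac{n^{3.5}\,d}{R-1}.$$ No measurability of $\tilde Q$ as a function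 of the sample point is required: both the displayed inequality and the bound $\frac{6}{\sqrt\pi}\frac{n^{3.5}d}{R-1}$ on the probability of the complementary event hold, with $\mathbb P$ read as outer probability if these events are not measurable. -/

import Mathlib

open MeasureTheory ProbabilityTheory
open scoped Matrix Matrix.Norms.Frobenius

/-- The off-diagonal part of a square matrix: diagonal entries are set to zero, all other
entries are kept. -/
def offDiag {n : ℕ} (M : Matrix (Fin n) (Fin n) ℝ) : Matrix (Fin n) (Fin n) ℝ :=
  Matrix.of fun i j => if i = j then 0 else M i j

/-- The linear combination `w₁ B₁ + ⋯ + w_d B_d` of a family of matrices. -/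
def linComb {n d : ℕ} (w : Fin d → ℝ) (B : Fin d → Matrix (Fin n) (Fin n) ℝ) :
    Matrix (Fin n) (Fin n) ℝ :=
  ∑ k, w k • B k

/-- `Q` is an orthogonal matrix such that `Qᵀ M Q` is diagonal. -/
def IsOrthogonalDiagonalizer {n : ℕ} (Q M : Matrix (Fin n) (Fin n) ℝ) : Prop :=
  Q ∈ Matrix.orthogonalGroup (Fin n) ℝ ∧ (Qᵀ * M * Q).IsDiag

/-- The joint off-diagonal error `(∑ₖ ‖offdiag (Qᵀ Bₖ Q)‖_F²)^{1/2}`; the norm is the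
Frobenius norm. -/
noncomputable def jointOffDiagError {n d : ℕ} (B : Fin d → Matrix (Fin n) (Fin n) ℝ)
    (Q : Matrix (Fin n) (Fin n) ℝ) : ℝ :=
  Real.sqrt (∑ k, ‖offDiag (Qᵀ * B k * Q)‖ ^ 2)

/-! Let `U` diagonalize all `A k` jointly, with joint eigenvalues `λᵢ ∈ ℝᵈ`. A generic projection
`λᵢ ↦ ⟨μ, λᵢ⟩` does not shrink the differences `λᵢ - λⱼ` much.

Deterministic half (`jointOffDiagError_le_of_lipschitz`): match each eigenvalue of the perturbed
combination to the nearest `⟨w, λᵢ⟩`. If `‖λᵢ - λⱼ‖ ≤ t |⟨w, λᵢ - λⱼ⟩|` for all pairs, the error is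
at most `(1 + 2t‖w‖)` times the size of `E`. No eigenvalue gap is needed, and `Q` may be any
diagonalizer.

Probabilistic half (`measure_abs_stdGaussian_inner_le`): with `t = (R - 1) / (2‖μ‖)` the error bound
is `R ε`. The condition fails for a pair only if `μ` is nearly orthogonal to `λᵢ - λⱼ`, which the
bounded Gaussian density makes unlikely; a union bound over at most `n²` pairs finishes. The
exceptional event depends on `μ` and `λ` alone, so measurability of `Q` never enters. -/

/-! ### Frobenius norm and joint diagonalization -/

theorem Matrix.frobenius_norm_sq {m n : Type*} [Fintype m] [Fintype n] (M : Matrix m n ℝ) :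
    ‖M‖ ^ 2 = ∑ i, ∑ j, M i j ^ 2 := by
  rw [Matrix.frobenius_norm_def, ← Real.sqrt_eq_rpow, Real.sq_sqrt (by positivity)]
  simp

theorem Matrix.frobenius_norm_sq_eq_trace {m n : Type*} [Fintype m] [Fintype n]
    (M : Matrix m n ℝ) : ‖M‖ ^ 2 = (Mᵀ * M).trace := by
  rw [Matrix.frobenius_norm_sq, Finset.sum_comm]
  simp [Matrix.trace, Matrix.mul_apply, sq]

theorem Matrix.frobenius_norm_mul_of_transpose_mul_self {m : Type*} [Fintype m] [DecidableEq m]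
    {U : Matrix m m ℝ} (hU : Uᵀ * U = 1) (M : Matrix m m ℝ) : ‖U * M‖ = ‖M‖ := by
  rw [← sq_eq_sq₀ (norm_nonneg _) (norm_nonneg _), frobenius_norm_sq_eq_trace,
    frobenius_norm_sq_eq_trace, transpose_mul, Matrix.mul_assoc, ← Matrix.mul_assoc Uᵀ, hU,
    Matrix.one_mul]

theorem Matrix.frobenius_norm_mul_of_mul_transpose_self {m : Type*} [Fintype m] [DecidableEq m]
    {U : Matrix m m ℝ} (hU : U * Uᵀ = 1) (M : Matrix m m ℝ) : ‖M * U‖ = ‖M‖ := by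
  rw [← frobenius_norm_transpose (M * U), transpose_mul,
    frobenius_norm_mul_of_transpose_mul_self (by simpa using hU), frobenius_norm_transpose]

/-- Simultaneous diagonalization of commuting real symmetric matrices. -/
theorem exists_joint_diagonalization {n : ℕ} {ι : Type*} (A : ι → Matrix (Fin n) (Fin n) ℝ)
    (hA : ∀ k, (A k).IsSymm) (hcomm : ∀ j k, Commute (A j) (A k)) :
    ∃ (U : Matrix (Fin n) (Fin n) ℝ) (l : ι → Fin n → ℝ), Uᵀ * U = 1 ∧
      ∀ k, A k * U = U * Matrix.diagonal (l k) := by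
  classical
  let T : ι → EuclideanSpace ℝ (Fin n) →ₗ[ℝ] EuclideanSpace ℝ (Fin n) :=
    fun k => Matrix.toEuclideanLin (A k)
  have hT : ∀ k, (T k).IsSymmetric := fun k => by
    refine Matrix.isSymmetric_toEuclideanLin_iff.mpr ?_
    rw [Matrix.IsHermitian, Matrix.conjTranspose_eq_transpose_of_trivial]
    exact hA k
  have hC : Pairwise (Function.onFun Commute T) := fun j k _ => by
    refine LinearMap.ext fun x => ?_
    simp only [T, Module.End.mul_apply, Matrix.toLpLin_apply, Matrix.mulVec_mulVec]
    rw [(hcomm j k).eq]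
  have hV := LinearMap.IsSymmetric.directSum_isInternal_of_pairwise_commute hT hC
  have hO := LinearMap.IsSymmetric.orthogonalFamily_iInf_eigenspaces hT
  -- The joint eigenspaces are indexed by all `γ : ι → ℝ`; only finitely many are nonzero, and a
  -- subordinate basis needs a finite index type.
  have hfin := WellFoundedGT.finite_ne_bot_of_iSupIndep hV.submodule_iSupIndep
  have : Fintype {γ : ι → ℝ // ⨅ j, Module.End.eigenspace (T j) (γ j) ≠ ⊥} := hfin.fintype
  have hV' := DirectSum.isInternal_ne_bot_iff.mpr hV
  have hO' := hO.comp (Subtype.val_injective (p := fun γ : ι → ℝ =>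
    ⨅ j, Module.End.eigenspace (T j) (γ j) ≠ ⊥))
  have hn : Module.finrank ℝ (EuclideanSpace ℝ (Fin n)) = n := by simp
  let b := DirectSum.IsInternal.subordinateOrthonormalBasis hn hV' hO'
  let l := fun a => (DirectSum.IsInternal.subordinateOrthonormalBasisIndex hn hV' a hO').1
  have hb : ∀ a k, T k (b a) = l a k • b a := fun a k => by
    have h := DirectSum.IsInternal.subordinateOrthonormalBasis_subordinate hn hV' a hO'
    exact Module.End.mem_eigenspace_iff.mp ((Submodule.mem_iInf _).mp h k)
  refine ⟨Matrix.of fun i j => b j i, fun k a => l a k, ?_, fun k => ?_⟩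
  · ext i j
    have h := (orthonormal_iff_ite.mp b.orthonormal) j i
    rw [PiLp.inner_apply] at h
    simpa [Matrix.mul_apply, Matrix.one_apply, eq_comm] using h
  · ext i j
    have h := congrArg (fun v => v i) (hb j k)
    rw [Matrix.mul_diagonal]
    simpa [T, Matrix.mul_apply, Matrix.mulVec, dotProduct, mul_comm] using h

/-! ### Deterministic perturbation bound -/

theorem norm_offDiag_le {n : ℕ} (M : Matrix (Fin n) (Fin n) ℝ) (c : Fin n → ℝ) :
    ‖offDiag M‖ ≤ ‖M - Matrix.diagonal c‖ := by
  rw [← sq_le_sq₀ (norm_nonneg _) (norm_nonneg _), Matrix.frobenius_norm_sq,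
    Matrix.frobenius_norm_sq]
  refine Finset.sum_le_sum fun i _ => Finset.sum_le_sum fun j _ => ?_
  by_cases h : i = j
  · simp [offDiag, h, sq_nonneg]
  · simp [offDiag, h]

/-- Minkowski's inequality for the `ℓ²` sum of norms, from Cauchy–Schwarz on the cross term. -/
theorem sqrt_sum_norm_add_sq_le {ι V : Type*} [SeminormedAddCommGroup V] (s : Finset ι)
    (F G : ι → V) :
    √(∑ k ∈ s, ‖F k + G k‖ ^ 2) ≤ √(∑ k ∈ s, ‖F k‖ ^ 2) + √(∑ k ∈ s, ‖G k‖ ^ 2) := by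
  refine Real.sqrt_le_iff.mpr ⟨by positivity, ?_⟩
  have h1 : ∑ k ∈ s, ‖F k + G k‖ ^ 2 ≤ ∑ k ∈ s, (‖F k‖ + ‖G k‖) ^ 2 := by
    gcongr; exact norm_add_le _ _
  have h2 := Real.sum_mul_le_sqrt_mul_sqrt s (fun k => ‖F k‖) (fun k => ‖G k‖)
  have h3 : ∑ k ∈ s, (‖F k‖ + ‖G k‖) ^ 2 =
      ∑ k ∈ s, ‖F k‖ ^ 2 + 2 * ∑ k ∈ s, ‖F k‖ * ‖G k‖ + ∑ k ∈ s, ‖G k‖ ^ 2 := by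
    rw [Finset.mul_sum, ← Finset.sum_add_distrib, ← Finset.sum_add_distrib]
    exact Finset.sum_congr rfl fun k _ => by ring
  have h4 := Real.sq_sqrt (Finset.sum_nonneg fun k (_ : k ∈ s) => sq_nonneg ‖F k‖)
  have h5 := Real.sq_sqrt (Finset.sum_nonneg fun k (_ : k ∈ s) => sq_nonneg ‖G k‖)
  nlinarith

/-- If the joint spectrum is a `t`-Lipschitz function of the spectrum of `∑ₖ wₖ Aₖ`, then an
orthogonal diagonalizer of `∑ₖ wₖ (Aₖ + Eₖ)` nearly diagonalizes every `Aₖ + Eₖ`. -/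
theorem jointOffDiagError_le_of_lipschitz {n d : ℕ} {A E : Fin d → Matrix (Fin n) (Fin n) ℝ}
    {U Q : Matrix (Fin n) (Fin n) ℝ} {l : Fin d → Fin n → ℝ} (hU : Uᵀ * U = 1)
    (hAU : ∀ k, A k * U = U * Matrix.diagonal (l k)) (hA : ∀ k, (A k).IsSymm) {w : Fin d → ℝ}
    (hQ : IsOrthogonalDiagonalizer Q (linComb w (fun k => A k + E k))) {t : ℝ} (ht : 0 ≤ t)
    (hl : ∀ i j, ∑ k, (l k i - l k j) ^ 2 ≤ t ^ 2 * (∑ k, w k * (l k i - l k j)) ^ 2) :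
    jointOffDiagError (fun k => A k + E k) Q ≤
      (1 + t * (2 * √(∑ k, w k ^ 2))) * √(∑ k, ‖E k‖ ^ 2) := by
  rcases isEmpty_or_nonempty (Fin n) with hn | hn
  · have : jointOffDiagError (fun k => A k + E k) Q = 0 := by
      simp [jointOffDiagError, Matrix.frobenius_norm_sq]
    rw [this]; positivity
  obtain ⟨hQo, hdiag⟩ := hQ
  have hU' : U * Uᵀ = 1 := mul_eq_one_comm.mp hU
  have hQ1 : Qᵀ * Q = 1 := by simpa using (Matrix.mem_orthogonalGroup_iff' (Fin n) ℝ).mp hQo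
  have hQ2 : Q * Qᵀ = 1 := mul_eq_one_comm.mp hQ1
  have hUA : ∀ k, Uᵀ * A k = Matrix.diagonal (l k) * Uᵀ := fun k => by
    have := congrArg Matrix.transpose (hAU k)
    rwa [Matrix.transpose_mul, Matrix.transpose_mul, (hA k).eq, Matrix.diagonal_transpose] at this
  set M := linComb w (fun k => A k + E k) with hM
  set W := Uᵀ * Q with hW
  let F : Fin d → Matrix (Fin n) (Fin n) ℝ := fun k => Uᵀ * E k * Q
  let α : Fin n → ℝ := fun i => ∑ k, w k * l k i
  let β : Fin n → ℝ := (Qᵀ * M * Q).diag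
  have hF : ∀ k, ‖F k‖ = ‖E k‖ := fun k => by
    rw [Matrix.frobenius_norm_mul_of_mul_transpose_self hQ2,
      Matrix.frobenius_norm_mul_of_transpose_mul_self (by simpa using hU')]
  have hMQ : M * Q = Q * Matrix.diagonal β := by
    rw [hdiag.diagonal_diag, ← Matrix.mul_assoc, ← Matrix.mul_assoc, hQ2, Matrix.one_mul]
  -- Compare the `(i, j)` entries of `Uᵀ M Q`, computed by diagonalizing `M` on the right and the `A
  -- k` on the left.
  have hent : ∀ i j, (α i - β j) * W i j = -∑ k, w k * F k i j := fun i j => by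
    have h1 : Uᵀ * (M * Q) = ∑ k, w k • (Matrix.diagonal (l k) * W + F k) := by
      rw [hM, linComb, Finset.sum_mul, Finset.mul_sum]
      refine Finset.sum_congr rfl fun k _ => ?_
      rw [Matrix.smul_mul, Matrix.mul_smul, Matrix.add_mul, Matrix.mul_add, ← Matrix.mul_assoc,
        ← Matrix.mul_assoc, hUA, Matrix.mul_assoc]
    rw [hMQ, ← Matrix.mul_assoc] at h1
    have h2 := congrFun (congrFun h1 i) j
    rw [Matrix.mul_diagonal, Matrix.sum_apply] at h2
    simp only [Matrix.smul_apply, Matrix.add_apply, Matrix.diagonal_mul, smul_eq_mul, mul_add,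
      Finset.sum_add_distrib] at h2
    have h3 : α i * W i j = ∑ k, w k * (l k i * W i j) := by
      simp only [α, Finset.sum_mul, mul_assoc]
    rw [sub_mul, h3]; linarith
  -- Since `α (m j)` is nearest to `β j`, `|α i - α (m j)| ≤ 2 |α i - β j|`: this is the factor 2 in
  -- the bound, and it lets `hent` control `G` by `F` entrywise.
  choose m hm using fun j => Finite.exists_min fun i => |α i - β j|
  let G : Fin d → Matrix (Fin n) (Fin n) ℝ :=
    fun k => Matrix.diagonal (l k) * W - W * Matrix.diagonal fun j => l k (m j)
  have hoff : ∀ k, ‖offDiag (Qᵀ * (A k + E k) * Q)‖ ≤ ‖F k + G k‖ := fun k => by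
    refine (norm_offDiag_le _ fun j => l k (m j)).trans_eq ?_
    have hX : Qᵀ * (A k + E k) * Q - Matrix.diagonal (fun j => l k (m j)) =
        (Qᵀ * U) * (F k + G k) := by
      have e1 : F k + G k = Uᵀ * ((A k + E k) * Q - Q * Matrix.diagonal fun j => l k (m j)) := by
        simp only [F, G, hW, Matrix.mul_sub, Matrix.add_mul, Matrix.mul_add, ← Matrix.mul_assoc,
          hUA]
        abel
      rw [e1, Matrix.mul_assoc Qᵀ U, ← Matrix.mul_assoc U, hU', Matrix.one_mul, Matrix.mul_sub,
        ← Matrix.mul_assoc Qᵀ Q, hQ1, Matrix.one_mul, Matrix.mul_assoc]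
    rw [hX]
    refine Matrix.frobenius_norm_mul_of_transpose_mul_self ?_ _
    rw [Matrix.transpose_mul, Matrix.transpose_transpose, Matrix.mul_assoc, ← Matrix.mul_assoc Q,
      hQ2, Matrix.one_mul, hU]
  have hG : ∑ k, ‖G k‖ ^ 2 ≤ (t * (2 * √(∑ k, w k ^ 2))) ^ 2 * ∑ k, ‖E k‖ ^ 2 := by
    simp only [← hF, Matrix.frobenius_norm_sq]
    rw [Finset.sum_comm, Finset.sum_comm (f := fun k i => ∑ j, F k i j ^ 2), Finset.mul_sum]
    refine Finset.sum_le_sum fun i _ => ?_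
    rw [Finset.sum_comm, Finset.sum_comm (f := fun k j => F k i j ^ 2), Finset.mul_sum]
    refine Finset.sum_le_sum fun j _ => ?_
    have h1 : ∑ k, G k i j ^ 2 = (∑ k, (l k i - l k (m j)) ^ 2) * W i j ^ 2 := by
      rw [Finset.sum_mul]
      refine Finset.sum_congr rfl fun k _ => ?_
      simp only [G, Matrix.sub_apply, Matrix.diagonal_mul, Matrix.mul_diagonal]
      ring
    have h2 : ∑ k, w k * (l k i - l k (m j)) = α i - α (m j) := by
      simp only [α, mul_sub, Finset.sum_sub_distrib]
    have h3 : (α i - α (m j)) ^ 2 ≤ 4 * (α i - β j) ^ 2 := by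
      have h := hm j i
      have h' : |α i - α (m j)| ≤ 2 * |α i - β j| := by
        calc |α i - α (m j)| = |(α i - β j) - (α (m j) - β j)| := by ring_nf
          _ ≤ |α i - β j| + |α (m j) - β j| := abs_sub _ _
          _ ≤ 2 * |α i - β j| := by linarith
      calc (α i - α (m j)) ^ 2 = |α i - α (m j)| ^ 2 := (sq_abs _).symm
        _ ≤ (2 * |α i - β j|) ^ 2 := by gcongr
        _ = _ := by rw [mul_pow, sq_abs]; norm_num
    have h4 := hl i (m j)
    rw [h2] at h4
    calc ∑ k, G k i j ^ 2 ≤ (t ^ 2 * (4 * (α i - β j) ^ 2)) * W i j ^ 2 := by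
          rw [h1]; gcongr; exact h4.trans (by gcongr)
      _ = 4 * t ^ 2 * (∑ k, w k * F k i j) ^ 2 := by
          rw [← neg_sq (∑ k, w k * F k i j), ← hent i j]; ring
      _ ≤ 4 * t ^ 2 * ((∑ k, w k ^ 2) * ∑ k, F k i j ^ 2) := by
          gcongr; exact Finset.sum_mul_sq_le_sq_mul_sq _ _ _
      _ = _ := by
          rw [mul_pow, mul_pow, Real.sq_sqrt (by positivity)]; ring
  calc jointOffDiagError (fun k => A k + E k) Q ≤ √(∑ k, ‖F k + G k‖ ^ 2) := by
        unfold jointOffDiagError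
        gcongr with k
        exact hoff k
    _ ≤ √(∑ k, ‖F k‖ ^ 2) + √(∑ k, ‖G k‖ ^ 2) := sqrt_sum_norm_add_sq_le _ _ _
    _ ≤ √(∑ k, ‖E k‖ ^ 2) + (t * (2 * √(∑ k, w k ^ 2))) * √(∑ k, ‖E k‖ ^ 2) := by
        simp only [hF]
        gcongr
        refine (Real.sqrt_le_sqrt hG).trans_eq ?_
        rw [Real.sqrt_mul (by positivity), Real.sqrt_sq (by positivity)]
    _ = _ := by ring

/-! ### Gaussian anti-concentration -/

/-- The density is at most `1 / √(2π)`. For negative `a` the set is empty and `ENNReal.ofReal`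
truncates to 0, so no sign condition is needed. -/
theorem gaussianReal_abs_le_le (a : ℝ) :
    gaussianReal 0 1 {x | |x| ≤ a} ≤ ENNReal.ofReal (2 / √(2 * Real.pi) * a) := by
  have hs : {x : ℝ | |x| ≤ a} = Set.Icc (-a) a := by ext x; simp [abs_le]
  rw [gaussianReal_apply 0 one_ne_zero, hs]
  calc ∫⁻ x in Set.Icc (-a) a, gaussianPDF 0 1 x
      ≤ ∫⁻ _ in Set.Icc (-a) a, ENNReal.ofReal (1 / √(2 * Real.pi)) := by
        refine lintegral_mono fun x => ENNReal.ofReal_le_ofReal ?_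
        rw [gaussianPDFReal, one_div]
        simp only [NNReal.coe_one, mul_one]
        refine mul_le_of_le_one_right (by positivity) (Real.exp_le_one_iff.mpr ?_)
        have := sq_nonneg (x - 0)
        linarith
    _ = ENNReal.ofReal (2 / √(2 * Real.pi) * a) := by
        rw [setLIntegral_const, Real.volume_Icc, ← ENNReal.ofReal_mul (by positivity)]
        congr 1; ring

/-- Anti-concentration of a standard Gaussian relative to an independent random scale. -/
theorem measure_abs_le_of_indepFun {Ω : Type*} [MeasurableSpace Ω] {P : Measure Ω}
    [IsProbabilityMeasure P] {g Z : Ω → ℝ} (hg : HasLaw g (gaussianReal 0 1) P)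
    (hZ : AEMeasurable Z P) (hgZ : IndepFun g Z P) :
    P {ω | |g ω| ≤ Z ω} ≤ ∫⁻ ω, ENNReal.ofReal (2 / √(2 * Real.pi) * Z ω) ∂P := by
  have hS : MeasurableSet {p : ℝ × ℝ | |p.1| ≤ p.2} :=
    measurableSet_le (by fun_prop) (by fun_prop)
  have : IsProbabilityMeasure (P.map Z) := Measure.isProbabilityMeasure_map hZ
  calc P {ω | |g ω| ≤ Z ω} = P.map (fun ω => (g ω, Z ω)) {p : ℝ × ℝ | |p.1| ≤ p.2} := by
        rw [Measure.map_apply_of_aemeasurable (hg.aemeasurable.prodMk hZ) hS]; rfl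
    _ = ∫⁻ z, gaussianReal 0 1 {x | |x| ≤ z} ∂P.map Z := by
        rw [(indepFun_iff_map_prod_eq_prod_map_map hg.aemeasurable hZ).mp hgZ, hg.map_eq,
          Measure.prod_apply_symm hS]
        rfl
    _ ≤ ∫⁻ z, ENNReal.ofReal (2 / √(2 * Real.pi) * z) ∂P.map Z :=
        lintegral_mono fun z => gaussianReal_abs_le_le z
    _ = _ := lintegral_map' (by fun_prop) hZ

theorem memLp_two_of_hasLaw_stdGaussian {Ω : Type*} [MeasurableSpace Ω] {P : Measure Ω} {X : Ω → ℝ}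
    (hX : HasLaw X (gaussianReal 0 1) P) : MemLp X 2 P :=
  hX.hasGaussianLaw.memLp_two

section Projection

variable {Ω : Type*} [MeasurableSpace Ω] {P : Measure Ω} [IsProbabilityMeasure P] {d : ℕ}
  {μ : Fin d → Ω → ℝ}

theorem covariance_stdGaussian_linear_combination (hμ : ∀ k, HasLaw (μ k) (gaussianReal 0 1) P)
    (hind : iIndepFun μ P) (u : Fin d → ℝ) (k : Fin d) :
    cov[μ k, fun ω => ∑ i, u i * μ i ω; P] = u k := by
  have hL := fun k => memLp_two_of_hasLaw_stdGaussian (hμ k)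
  rw [covariance_fun_sum_right (fun i => (hL i).const_mul (u i)) (hL k)]
  simp only [covariance_const_mul_right]
  rw [Finset.sum_eq_single k]
  · rw [covariance_self (hμ k).aemeasurable, (hμ k).variance_eq, variance_id_gaussianReal]
    simp
  · intro i _ hik
    rw [(hind.indepFun hik.symm).covariance_eq_zero (hL k) (hL i), mul_zero]
  · simp

theorem variance_stdGaussian_linear_combination (hμ : ∀ k, HasLaw (μ k) (gaussianReal 0 1) P)
    (hind : iIndepFun μ P) (u : Fin d → ℝ) :
    cov[fun ω => ∑ i, u i * μ i ω, fun ω => ∑ i, u i * μ i ω; P] = ∑ i, u i ^ 2 := by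
  have hL := fun k => memLp_two_of_hasLaw_stdGaussian (hμ k)
  rw [covariance_fun_sum_left (fun i => (hL i).const_mul (u i))
    (memLp_finsetSum _ fun i _ => (hL i).const_mul (u i))]
  simp only [covariance_const_mul_left, covariance_stdGaussian_linear_combination hμ hind, sq]

theorem hasLaw_stdGaussian_linear_combination (hμ : ∀ k, HasLaw (μ k) (gaussianReal 0 1) P)
    (hind : iIndepFun μ P) {u : Fin d → ℝ} (hu : ∑ k, u k ^ 2 = 1) :
    HasLaw (fun ω => ∑ i, u i * μ i ω) (gaussianReal 0 1) P := by
  have hG := iIndepFun.hasGaussianLaw (fun k => (hμ k).hasGaussianLaw) hind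
  have hg : HasGaussianLaw (fun ω => ∑ i, u i * μ i ω) P := by
    have := hG.map_fun (∑ i, u i • ContinuousLinearMap.proj (R := ℝ) (φ := fun _ : Fin d => ℝ) i)
    simpa using this
  refine ⟨hg.aemeasurable, ?_⟩
  rw [hg.map_eq_gaussianReal, ← covariance_self hg.aemeasurable,
    variance_stdGaussian_linear_combination hμ hind, hu]
  have h0 : ∫ ω, ∑ i, u i * μ i ω ∂P = 0 := by
    rw [integral_finsetSum _ fun i _ =>
      ((memLp_two_of_hasLaw_stdGaussian (hμ i)).integrable one_le_two).const_mul _]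
    refine Finset.sum_eq_zero fun i _ => ?_
    rw [integral_const_mul, (hμ i).integral_eq, integral_id_gaussianReal, mul_zero]
  rw [h0, Real.toNNReal_one]

/-- The component of a standard Gaussian vector along a unit vector is independent of the
orthogonal component. -/
theorem indepFun_stdGaussian_orthogonal_component
    (hμ : ∀ k, HasLaw (μ k) (gaussianReal 0 1) P)
    (hind : iIndepFun μ P) {u : Fin d → ℝ} (hu : ∑ k, u k ^ 2 = 1) :
    IndepFun (fun ω => ∑ i, u i * μ i ω) (fun ω k => μ k ω - u k * ∑ i, u i * μ i ω) P := by
  have hL := fun k => memLp_two_of_hasLaw_stdGaussian (hμ k)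
  have hG := iIndepFun.hasGaussianLaw (fun k => (hμ k).hasGaussianLaw) hind
  have hgL : MemLp (fun ω => ∑ i, u i * μ i ω) 2 P :=
    memLp_finsetSum _ fun i _ => (hL i).const_mul (u i)
  -- Both components are a linear image of one Gaussian vector, hence jointly Gaussian, so zero
  -- covariance gives independence. The scalar is viewed as a `Unit`-indexed family to fit the
  -- coordinatewise criterion.
  let p : Fin d → (Fin d → ℝ) →L[ℝ] ℝ := ContinuousLinearMap.proj
  let s : (Fin d → ℝ) →L[ℝ] ℝ := ∑ i, u i • p i
  let Φ : (Fin d → ℝ) →L[ℝ] (Unit → ℝ) × (Fin d → ℝ) :=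
    (ContinuousLinearMap.pi fun _ => s).prod (ContinuousLinearMap.pi fun k => p k - u k • s)
  have hΦ : HasGaussianLaw (fun ω => ((fun _ : Unit => ∑ i, u i * μ i ω),
      fun k => μ k ω - u k * ∑ i, u i * μ i ω)) P := by
    convert! hG.map_fun Φ using 2 with ω
    simp [Φ, s, p]
  have h := hΦ.indepFun_of_covariance_eval (X := fun _ : Unit => fun ω => ∑ i, u i * μ i ω)
    (Y := fun k ω => μ k ω - u k * ∑ i, u i * μ i ω) fun _ k => by
      rw [covariance_fun_sub_right hgL (hL k) (hgL.const_mul _), covariance_const_mul_right,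
        covariance_comm, covariance_stdGaussian_linear_combination hμ hind,
        variance_stdGaussian_linear_combination hμ hind, hu, mul_one, sub_self]
  exact h.comp (φ := fun v : Unit → ℝ => v ()) (ψ := id) (by fun_prop) measurable_id

/-- By AM–GM, `√S ≤ (S / √d + √d) / 2`, and `S = ∑ k, μ k ^ 2` has mean `d`. -/
theorem lintegral_norm_stdGaussian_le (hμ : ∀ k, HasLaw (μ k) (gaussianReal 0 1) P)
    (hd : 0 < d) {C : ℝ} (hC : 0 ≤ C) :
    ∫⁻ ω, ENNReal.ofReal (C * √(∑ k, μ k ω ^ 2)) ∂P ≤ ENNReal.ofReal (C * √d) := by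
  have hL := fun k => memLp_two_of_hasLaw_stdGaussian (hμ k)
  have hd' : 0 < √(d : ℝ) := by positivity
  have hsq : ∀ k, Integrable (fun ω => μ k ω ^ 2) P := fun k => (hL k).integrable_sq
  have hint : Integrable (fun ω => C * ((∑ k, μ k ω ^ 2) / √d + √d) / 2) P :=
    ((((integrable_finsetSum _ fun k _ => hsq k).div_const _).add
      (integrable_const _)).const_mul _).div_const _
  have h1 : ∀ k, ∫ ω, μ k ω ^ 2 ∂P = 1 := fun k => by
    have h := (hμ k).variance_eq
    rw [variance_id_gaussianReal, variance_of_integral_eq_zero (hμ k).aemeasurable] at h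
    · simpa using h
    · rw [(hμ k).integral_eq, integral_id_gaussianReal]
  calc ∫⁻ ω, ENNReal.ofReal (C * √(∑ k, μ k ω ^ 2)) ∂P
      ≤ ∫⁻ ω, ENNReal.ofReal (C * ((∑ k, μ k ω ^ 2) / √d + √d) / 2) ∂P := by
        refine lintegral_mono fun ω => ENNReal.ofReal_le_ofReal ?_
        rw [mul_div_assoc]
        refine mul_le_mul_of_nonneg_left ?_ hC
        have hS : 0 ≤ ∑ k, μ k ω ^ 2 := by positivity
        rw [le_div_iff₀ two_pos, ← sub_le_iff_le_add, le_div_iff₀ hd']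
        nlinarith [Real.sq_sqrt hS, sq_nonneg (√(∑ k, μ k ω ^ 2) - √d)]
    _ = ENNReal.ofReal (C * √d) := by
        rw [← ofReal_integral_eq_lintegral_ofReal hint (Filter.Eventually.of_forall fun ω => by
          positivity)]
        congr 1
        rw [integral_div, integral_const_mul, integral_add
          ((integrable_finsetSum _ fun k _ => hsq k).div_const _) (integrable_const _),
          integral_div, integral_finsetSum _ fun k _ => hsq k]
        simp only [h1, Finset.sum_const, Finset.card_univ, Fintype.card_fin, integral_const,
          probReal_univ, smul_eq_mul, nsmul_eq_mul, mul_one, one_mul, Real.div_sqrt]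
        ring

/-- A standard Gaussian vector is unlikely to be nearly orthogonal to a fixed direction. -/
theorem measure_abs_stdGaussian_inner_le (hμ : ∀ k, HasLaw (μ k) (gaussianReal 0 1) P)
    (hind : iIndepFun μ P) {v : Fin d → ℝ} (hv : v ≠ 0) {s : ℝ} (hs : 2 < s) :
    P {ω | s * |∑ k, μ k ω * v k| ≤ 2 * √(∑ k, μ k ω ^ 2) * √(∑ k, v k ^ 2)} ≤
      ENNReal.ofReal (2 / √(2 * Real.pi) * (2 / (s - 2)) * √d) := by
  obtain ⟨k₀, hk₀⟩ := Function.ne_iff.mp hv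
  have hd : 0 < d := k₀.pos
  have hv2 : 0 < ∑ k, v k ^ 2 :=
    Finset.sum_pos' (fun k _ => sq_nonneg _) ⟨k₀, Finset.mem_univ _, by
      have : v k₀ ≠ 0 := hk₀
      positivity⟩
  have hr : 0 < √(∑ k, v k ^ 2) := Real.sqrt_pos.mpr hv2
  set r := √(∑ k, v k ^ 2) with hr_def
  let u : Fin d → ℝ := fun k => v k / r
  have hu : ∑ k, u k ^ 2 = 1 := by
    simp only [u, div_pow, ← Finset.sum_div]
    rw [hr_def, Real.sq_sqrt hv2.le, div_self hv2.ne']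
  let g : Ω → ℝ := fun ω => ∑ i, u i * μ i ω
  let Y : Ω → Fin d → ℝ := fun ω k => μ k ω - u k * g ω
  have hμm := fun k => (hμ k).aemeasurable
  have hY : AEMeasurable Y P := by fun_prop
  have hgl := hasLaw_stdGaussian_linear_combination hμ hind hu
  have hindY := indepFun_stdGaussian_orthogonal_component hμ hind hu
  have hφ : Measurable fun y : Fin d → ℝ => 2 / (s - 2) * √(∑ k, y k ^ 2) := by fun_prop
  have hpyth : ∀ ω, ∑ k, μ k ω ^ 2 = g ω ^ 2 + ∑ k, Y ω k ^ 2 := fun ω => by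
    have h1 : ∑ k, Y ω k ^ 2 = ∑ k, μ k ω ^ 2 - ∑ k, 2 * g ω * (u k * μ k ω) +
        ∑ k, g ω ^ 2 * u k ^ 2 := by
      rw [← Finset.sum_sub_distrib, ← Finset.sum_add_distrib]
      exact Finset.sum_congr rfl fun k _ => by simp only [Y]; ring
    rw [h1, ← Finset.mul_sum, ← Finset.mul_sum, hu]; simp only [g]; ring
  have hs2 : 0 < s - 2 := by linarith
  calc P {ω | s * |∑ k, μ k ω * v k| ≤ 2 * √(∑ k, μ k ω ^ 2) * r}
      ≤ P {ω | |g ω| ≤ 2 / (s - 2) * √(∑ k, Y ω k ^ 2)} := by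
        refine measure_mono fun ω hω => ?_
        simp only [Set.mem_ofPred_eq] at hω ⊢
        have h1 : ∑ k, μ k ω * v k = g ω * r := by
          simp only [g, u, Finset.sum_mul]
          exact Finset.sum_congr rfl fun k _ => by field_simp
        rw [h1, abs_mul, abs_of_pos hr, ← mul_assoc] at hω
        have h2 := le_of_mul_le_mul_right hω hr
        -- The threshold `2‖μ‖` depends on `g`. Moving its `2|g|` part to the left leaves `(s -
        -- 2)|g| ≤ 2‖Y‖`, whose right side is independent of `g`; hence `2 < s`.
        have h3 : √(∑ k, μ k ω ^ 2) ≤ |g ω| + √(∑ k, Y ω k ^ 2) := by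
          rw [hpyth]
          refine Real.sqrt_le_iff.mpr ⟨by positivity, ?_⟩
          have h4 := Real.sq_sqrt (show 0 ≤ ∑ k, Y ω k ^ 2 by positivity)
          have h5 : 0 ≤ |g ω| * √(∑ k, Y ω k ^ 2) := by positivity
          nlinarith [sq_abs (g ω)]
        rw [div_mul_eq_mul_div, le_div_iff₀ hs2]
        linarith
    _ ≤ ∫⁻ ω, ENNReal.ofReal (2 / √(2 * Real.pi) * (2 / (s - 2) * √(∑ k, Y ω k ^ 2))) ∂P :=
        measure_abs_le_of_indepFun hgl (hφ.comp_aemeasurable hY)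
          (hindY.comp measurable_id hφ)
    _ ≤ ∫⁻ ω, ENNReal.ofReal (2 / √(2 * Real.pi) * (2 / (s - 2)) * √(∑ k, μ k ω ^ 2)) ∂P := by
        refine lintegral_mono fun ω => ENNReal.ofReal_le_ofReal ?_
        rw [mul_assoc]
        refine mul_le_mul_of_nonneg_left (mul_le_mul_of_nonneg_left
          (Real.sqrt_le_sqrt ?_) (by positivity)) (by positivity)
        linarith [hpyth ω, sq_nonneg (g ω)]
    _ ≤ _ := lintegral_norm_stdGaussian_le hμ hd (by positivity)

end Projection

/-! ### Union bound and conclusion -/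

theorem jointOffDiagError_tail_bound {n d : ℕ} (A E : Fin d → Matrix (Fin n) (Fin n) ℝ)
    (hA_symm : ∀ k, (A k).IsSymm) (hA_comm : ∀ j k, Commute (A j) (A k))
    (ε : ℝ) (hE : Real.sqrt (∑ k, ‖E k‖ ^ 2) ≤ ε)
    {Ω : Type*} [MeasurableSpace Ω] (P : Measure Ω) [IsProbabilityMeasure P]
    (μ : Fin d → Ω → ℝ) (hμ_law : ∀ k, HasLaw (μ k) (gaussianReal 0 1) P)
    (hμ_indep : iIndepFun μ P)
    (Q : Ω → Matrix (Fin n) (Fin n) ℝ)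
    (hQ : ∀ᵐ ω ∂P, IsOrthogonalDiagonalizer (Q ω)
      (linComb (fun k => μ k ω) (fun k => A k + E k)))
    (R : ℝ) (hR : 1 < R) :
    P {ω | R * ε < jointOffDiagError (fun k => A k + E k) (Q ω)} ≤
      ENNReal.ofReal (6 / √Real.pi * ((n : ℝ) ^ (7 / 2 : ℝ) * d / (R - 1))) := by
  classical
  obtain ⟨U, l, hU, hAU⟩ := exists_joint_diagonalization A hA_symm hA_comm
  set s := R - 1 with hs
  have hs0 : 0 < s := by linarith
  -- Pairs with equal joint eigenvalues satisfy the Lipschitz condition trivially and must be left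
  -- out, as they would be bad for every `ω`.
  let S : Finset (Fin n × Fin n) := {p | (fun k => l k p.1 - l k p.2) ≠ 0}
  let bad : Fin n × Fin n → Set Ω := fun p =>
    {ω | s * |∑ k, μ k ω * (l k p.1 - l k p.2)| ≤
      2 * √(∑ k, μ k ω ^ 2) * √(∑ k, (l k p.1 - l k p.2) ^ 2)}
  have hsub : P {ω | R * ε < jointOffDiagError (fun k => A k + E k) (Q ω)} ≤
      P (⋃ p ∈ S, bad p) := by
    refine measure_mono_ae ?_
    filter_upwards [hQ] with ω hω hlt
    by_contra hnot
    have hnot' : ω ∉ ⋃ p ∈ S, bad p := hnot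
    simp only [Set.mem_iUnion, not_exists] at hnot'
    set N := √(∑ k, μ k ω ^ 2) with hN
    have hN0 : 0 ≤ N := Real.sqrt_nonneg _
    -- The constant `t = s / (2N)` makes `1 + t * (2N) = 1 + s = R`. If `N = 0`, then `t = 0` by
    -- convention; avoiding every bad event then forces all pairs to be degenerate.
    have ht : 0 ≤ s / (2 * N) := by positivity
    have hl : ∀ i j, ∑ k, (l k i - l k j) ^ 2 ≤
        (s / (2 * N)) ^ 2 * (∑ k, μ k ω * (l k i - l k j)) ^ 2 := fun i j => by
      by_cases hp : (fun k => l k i - l k j) = 0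
      · have h0 : ∀ k, l k i - l k j = 0 := fun k => congrFun hp k
        simp [h0]
      have h1 := hnot' (i, j) (by simpa [S] using hp)
      simp only [bad, Set.mem_ofPred_eq, not_le] at h1
      rcases hN0.eq_or_lt with h0 | hNpos
      · have h2 : ∑ k, μ k ω ^ 2 = 0 := (Real.sqrt_eq_zero (by positivity)).mp (hN ▸ h0.symm)
        have h3 : ∀ k, μ k ω = 0 := fun k => by
          simpa using (Finset.sum_eq_zero_iff_of_nonneg fun k _ => sq_nonneg (μ k ω)).mp h2 k
            (Finset.mem_univ k)
        rw [← hN, ← h0] at h1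
        simp [h3] at h1
      · have h2 : √(∑ k, (l k i - l k j) ^ 2) ≤
            s / (2 * N) * |∑ k, μ k ω * (l k i - l k j)| := by
          rw [div_mul_eq_mul_div, le_div_iff₀ (by positivity)]
          linarith
        rw [← sq_abs (∑ k, μ k ω * (l k i - l k j)), ← mul_pow]
        exact (Real.sqrt_le_left (by positivity)).mp h2
    have h := jointOffDiagError_le_of_lipschitz hU hAU hA_symm hω ht hl
    have hts : s / (2 * N) * (2 * N) ≤ s := by
      rcases hN0.eq_or_lt with h0 | hNpos
      · simp [← h0, hs0.le]
      · rw [div_mul_cancel₀ _ (by positivity)]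
    have : (1 + s / (2 * N) * (2 * N)) * √(∑ k, ‖E k‖ ^ 2) ≤ R * ε := by
      gcongr
      linarith
    have hlt' : R * ε < jointOffDiagError (fun k => A k + E k) (Q ω) := hlt
    rw [← hN] at h
    linarith
  refine hsub.trans ?_
  rcases S.eq_empty_or_nonempty with hS | ⟨⟨i, j⟩, hij⟩
  · simp [hS]
  have hv : (fun k => l k i - l k j) ≠ 0 := by simpa [S] using hij
  have hne : i ≠ j := by rintro rfl; exact hv (by ext k; simp)
  obtain ⟨k₀, _⟩ := Function.ne_iff.mp hv
  have hd : (1 : ℝ) ≤ d := by exact_mod_cast k₀.pos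
  have hn : (2 : ℝ) ≤ n := by
    have := i.2; have := j.2
    have : (i : ℕ) ≠ j := fun h => hne (Fin.ext h)
    exact_mod_cast (by omega : 2 ≤ n)
  -- A nondegenerate pair forces `n ≥ 2`, so a spare power of `n` absorbs the constant 2 left by the
  -- union bound.
  have hpow : 2 * (n : ℝ) ^ 2 ≤ (n : ℝ) ^ (7 / 2 : ℝ) := by
    have h1 : (n : ℝ) ^ (3 : ℝ) ≤ (n : ℝ) ^ (7 / 2 : ℝ) :=
      Real.rpow_le_rpow_of_exponent_le (by linarith) (by norm_num)
    have h2 : (n : ℝ) ^ (3 : ℝ) = (n : ℝ) ^ 3 := by exact_mod_cast Real.rpow_natCast (n : ℝ) 3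
    rw [h2] at h1
    nlinarith [sq_nonneg (n : ℝ)]
  have hπ0 : 0 < √Real.pi := Real.sqrt_pos.mpr Real.pi_pos
  have hπ2 : √Real.pi ≤ 2 := Real.sqrt_le_iff.mpr ⟨by norm_num, by linarith [Real.pi_le_four]⟩
  -- For `s ≤ 3` the claimed bound is at least 1. For `s > 3`, `2 / (s - 2) ≤ 6 / s`, which is where
  -- the constant 6 comes from.
  rcases le_or_gt s 3 with hs3 | hs3
  · refine prob_le_one.trans ?_
    rw [← ENNReal.ofReal_one]
    refine ENNReal.ofReal_le_ofReal ?_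
    have h1 : 1 ≤ 6 / √Real.pi := (one_le_div hπ0).mpr (by linarith)
    have h2 : 1 ≤ (n : ℝ) ^ (7 / 2 : ℝ) * d / s := by
      rw [one_le_div hs0]
      nlinarith
    nlinarith
  calc P (⋃ p ∈ S, bad p) ≤ ∑ p ∈ S, P (bad p) := measure_biUnion_finset_le _ _
    _ ≤ ∑ _p ∈ S, ENNReal.ofReal (2 / √(2 * Real.pi) * (2 / (s - 2)) * √d) :=
        Finset.sum_le_sum fun p hp => measure_abs_stdGaussian_inner_le hμ_law hμ_indep
          (by simpa [S] using hp) (by linarith)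
    _ = ENNReal.ofReal (S.card * (2 / √(2 * Real.pi) * (2 / (s - 2)) * √d)) := by
        rw [Finset.sum_const, nsmul_eq_mul,
          ENNReal.ofReal_mul (p := (S.card : ℝ)) (by positivity), ENNReal.ofReal_natCast]
    _ ≤ _ := by
        refine ENNReal.ofReal_le_ofReal ?_
        have hcard : (S.card : ℝ) ≤ (n : ℝ) ^ 2 := by
          have := Finset.card_le_univ S
          rw [Fintype.card_prod, Fintype.card_fin, ← sq] at this
          exact_mod_cast this
        have h2 : 2 / √(2 * Real.pi) ≤ 2 / √Real.pi := by
          gcongr; linarith [Real.pi_pos]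
        have h3 : 2 / (s - 2) ≤ 6 / s := by
          rw [div_le_div_iff₀ (by linarith) hs0]; linarith
        have h4 : √(d : ℝ) ≤ d := Real.sqrt_le_iff.mpr ⟨by linarith, by nlinarith⟩
        have h5 : 0 ≤ 2 / (s - 2) := div_nonneg two_pos.le (by linarith)
        calc (S.card : ℝ) * (2 / √(2 * Real.pi) * (2 / (s - 2)) * √d)
            ≤ (n : ℝ) ^ 2 * (2 / √Real.pi * (6 / s) * d) := by gcongr
          _ = 6 / √Real.pi * ((2 * (n : ℝ) ^ 2) * d / s) := by ring
          _ ≤ _ := by gcongr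

theorem theorem3p3 {n d : ℕ} (A E : Fin d → Matrix (Fin n) (Fin n) ℝ)
    (hA_symm : ∀ k, (A k).IsSymm) (hA_comm : ∀ j k, Commute (A j) (A k))
    (hE_symm : ∀ k, (E k).IsSymm)
    (ε : ℝ) (hε : 0 < ε) (hE : Real.sqrt (∑ k, ‖E k‖ ^ 2) ≤ ε)
    {Ω : Type*} [MeasurableSpace Ω] (P : Measure Ω) [IsProbabilityMeasure P]
    (μ : Fin d → Ω → ℝ) (hμ_law : ∀ k, HasLaw (μ k) (gaussianReal 0 1) P)
    (hμ_indep : iIndepFun μ P)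
    (Q : Ω → Matrix (Fin n) (Fin n) ℝ)
    (hQ : ∀ᵐ ω ∂P, IsOrthogonalDiagonalizer (Q ω)
      (linComb (fun k => μ k ω) (fun k => A k + E k)))
    (R : ℝ) (hR : 1 < R) :
    1 - 6 / Real.sqrt Real.pi * ((n : ℝ) ^ (7 / 2 : ℝ) * d / (R - 1)) ≤
        P.real {ω | jointOffDiagError (fun k => A k + E k) (Q ω) ≤ R * ε} ∧
      P.real {ω | R * ε < jointOffDiagError (fun k => A k + E k) (Q ω)} ≤
        6 / Real.sqrt Real.pi * ((n : ℝ) ^ (7 / 2 : ℝ) * d / (R - 1)) := by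
  have hR' : 0 < R - 1 := by linarith
  have hbad : P.real {ω | R * ε < jointOffDiagError (fun k => A k + E k) (Q ω)} ≤
      6 / √Real.pi * ((n : ℝ) ^ (7 / 2 : ℝ) * d / (R - 1)) :=
    ENNReal.toReal_le_of_le_ofReal (by positivity)
      (jointOffDiagError_tail_bound A E hA_symm hA_comm ε hE P μ hμ_law hμ_indep Q hQ R hR)
  refine ⟨?_, hbad⟩
  -- Subadditivity on the cover of the whole space replaces the complement rule, which would require
  -- measurable events.
  have hunion : {ω | jointOffDiagError (fun k => A k + E k) (Q ω) ≤ R * ε} ∪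
      {ω | R * ε < jointOffDiagError (fun k => A k + E k) (Q ω)} = Set.univ := by
    ext ω; simp [le_or_gt]
  have h := measureReal_union_le (μ := P)
    {ω | jointOffDiagError (fun k => A k + E k) (Q ω) ≤ R * ε}
    {ω | R * ε < jointOffDiagError (fun k => A k + E k) (Q ω)}
  rw [hunion, probReal_univ] at h
  linarith
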